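/- Consider series damped elastic actuation under velocity-sourced impedance control with a virtual coupler, i.e. the linear time-invariant two-port with \[ \begin{bmatrix}F_{\rm int}\\ v_e\end{bmatrix}=H\begin{bmatrix}-v_h\\ F_e\end{bmatrix},\qquad H=\begin{bmatrix}h_{11}&h_{12}\\-1&h_{22}\end{bmatrix},\qquad h_{22}=\frac{s}{b_{22}s+k_{22}}, \] \[ h_{11}=\frac{B_fMs^4+(B_f(B+P_m)+K_fM)s^3+(B_fI_m+K_f(B+P_m))s^2+K_fI_ms}{a_4s^4+a_3s^3+a_2s^2+a_1s+a_0}, \] \[ h_{12}=\frac{B_fP_mP_fs^3+P_mP_f(K_f+B_f(\mu+\nu))s^2+(B_fI_mI_f+K_fP_mP_f(\mu+\nu))s+K_fI_mI_f}{a_4s^4+a_3s^3+a_2s^2+a_1s+a_0}, \] where $\mu=I_m/P_m$, $\nu=I_f/P_f$, $a_4=M$, $a_3=B+P_m+B_f(\alpha+P_mP_f)$, $a_2=I_m+K_f(\alpha+P_mP_f)+B_fP_mP_f(\mu+\nu)$, $a_1=B_fI_mI_f+K_fP_mP_f(\mu+\nu)$, $a_0=K_fI_mI_f$. Let $K_f,M,B,P_m,P_f>0$,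 $B_f,I_m,I_f,b_{22},k_{22}\ge 0$, $0\le\alpha\le1$, and suppose that $I_m+\alpha K_f\neq0$ (so that the bound below is defined). Then: 1. If $I_f\neq0$, the two-port is passive and the virtual coupler has stiffness $k_{22}\neq0$, then $I_m\neq0$. This holds for each of the following two meanings of "passive". - (Energy) For all smooth inputs $u_1,u_2:\mathbb R\to\mathbb R$ vanishing on $(-\infty,0]$, with zero-state responses $y=Hu$, one has $\int_0^T(y_1u_1+y_2u_2)\,dt\ge0$ for all $T\ge0$. - (Frequency domain) The entries of $H$ have no poles in the open right half plane; their poles on the imaginary axis are simple with real positive residues; and, for all real $\omega$ for which $i\omega$ is not a pole of an entry, $\operatorname{Re}h_{11}\ge0$, $\operatorname{Re}h_{22}\ge0$ and $\operatorname{Re}h_{11}\operatorname{Re}h_{22}-\left|\tfrac{h_{12}^*+h_{21}}{2}\right|^2\ge0$ at $s=i\omega$, where $h_{21}=-1$. 2. If $I_m=0$, then the bound \[ k_{22}^2\le 4\,b_{22}\,I_m\,(I_mP_f-BI_f)\left(\frac{K_f}{I_m+\alpha K_f}\right)^2 \] forces $k_{22}=0$. -/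

import Mathlib

open Polynomial
open scoped ContDiff

noncomputable section

/-- The constant-coefficient differential operator `p(d/dt)` applied to a signal. -/
def diffOp (p : ℝ[X]) (u : ℝ → ℝ) : ℝ → ℝ :=
  fun t => p.sum fun i c => c * iteratedDeriv i u t

/-- Admissible signals: smooth, and at rest up to time `0`. -/
def IsRestSignal (u : ℝ → ℝ) : Prop :=
  ContDiff ℝ ∞ u ∧ ∀ t ≤ 0, u t = 0

/-- `y` is the zero-state response to the input `u` of the system with transfer function `h`:
writing `h = n / d` in lowest terms, `d(d/dt) y = n(d/dt) u`, the system being at rest up to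
time `0`. -/
def IsResponse (h : RatFunc ℝ) (u y : ℝ → ℝ) : Prop :=
  IsRestSignal y ∧ diffOp h.denom y = diffOp h.num u

/-- Two-port passivity in the sense of energy. The network with hybrid matrix `H`, i.e.
`(F₁, v₂) = H (v₁, F₂)`, started at rest, never delivers energy: for all inputs `v₁`, `F₂` the
energy `∫ (F₁ v₁ + F₂ v₂)` absorbed through the two ports up to any time is non-negative. Here
`y i j` is the contribution of the `j`-th input to the `i`-th output. -/
def TwoPortPassive (H : Matrix (Fin 2) (Fin 2) (RatFunc ℝ)) : Prop :=
  ∀ (u : Fin 2 → ℝ → ℝ) (y : Fin 2 → Fin 2 → ℝ → ℝ),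
    (∀ j, IsRestSignal (u j)) → (∀ i j, IsResponse (H i j) (u j) (y i j)) →
      ∀ T : ℝ, 0 ≤ T → 0 ≤ ∫ t in (0 : ℝ)..T, ∑ i, (∑ j, y i j t) * u i t

/-- `s` is a pole of the rational function `h` (`num` and `denom` are coprime). -/
def IsPole (h : RatFunc ℝ) (s : ℂ) : Prop :=
  aeval s h.denom = 0

/-- `s` is a simple pole of the rational function `h`. -/
def IsSimplePole (h : RatFunc ℝ) (s : ℂ) : Prop :=
  IsPole h s ∧ aeval s (derivative h.denom) ≠ 0

/-- The residue of the rational function `h` at a simple pole `s`. -/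
def simpleResidue (h : RatFunc ℝ) (s : ℂ) : ℂ :=
  aeval s h.num / aeval s (derivative h.denom)

/-- The value of the transfer function `h` at a complex frequency `s` which is not a pole. -/
def freqResponse (h : RatFunc ℝ) (s : ℂ) : ℂ :=
  h.eval (algebraMap ℝ ℂ) s

/-- Two-port passivity in the frequency domain, as conditions on the `h`-parameters:
(a) no poles in the open right half plane; (b) poles on the imaginary axis are simple with real
positive residues; (c) the real-part conditions at all real frequencies (that are not poles). -/
structure TwoPortPassiveFreq (H : Matrix (Fin 2) (Fin 2) (RatFunc ℝ)) : Prop where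
  no_rhp_pole : ∀ (i j : Fin 2) (s : ℂ), 0 < s.re → ¬ IsPole (H i j) s
  imag_pole : ∀ (i j : Fin 2) (w : ℝ), IsPole (H i j) (w * Complex.I) →
    IsSimplePole (H i j) (w * Complex.I) ∧
      (simpleResidue (H i j) (w * Complex.I)).im = 0 ∧
      0 < (simpleResidue (H i j) (w * Complex.I)).re
  real_part : ∀ w : ℝ, (∀ i j, ¬ IsPole (H i j) (w * Complex.I)) →
    0 ≤ (freqResponse (H 0 0) (w * Complex.I)).re ∧
    0 ≤ (freqResponse (H 1 1) (w * Complex.I)).re ∧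
    0 ≤ (freqResponse (H 0 0) (w * Complex.I)).re * (freqResponse (H 1 1) (w * Complex.I)).re
      - ‖(starRingEnd ℂ (freqResponse (H 0 1) (w * Complex.I))
          + freqResponse (H 1 0) (w * Complex.I)) / 2‖ ^ 2

/-- Parameters of series damped elastic actuation (SDEA) under velocity-sourced impedance
control (VSIC) with a virtual coupler. -/
structure SDEA where
  /-- actuator mass -/
  M : ℝ
  /-- actuator viscous friction -/
  B : ℝ
  /-- stiffness of the physical spring -/
  Kf : ℝ
  /-- damping of the physical damper -/
  Bf : ℝ
  /-- proportional gain of the motion controller -/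
  Pm : ℝ
  /-- integral gain of the motion controller -/
  Im : ℝ
  /-- proportional gain of the force controller -/
  Pf : ℝ
  /-- integral gain of the force controller -/
  If : ℝ
  /-- the feed-forward action compensates for the portion `1 - α` of the interaction force -/
  α : ℝ
  /-- damping of the virtual coupler -/
  b22 : ℝ
  /-- stiffness of the virtual coupler -/
  k22 : ℝ

namespace SDEA

variable (S : SDEA)

def μ : ℝ := S.Im / S.Pm

def ν : ℝ := S.If / S.Pf

def a4 : ℝ := S.M

def a3 : ℝ := S.B + S.Pm + S.Bf * (S.α + S.Pm * S.Pf)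

def a2 : ℝ := S.Im + S.Kf * (S.α + S.Pm * S.Pf) + S.Bf * S.Pm * S.Pf * (S.μ + S.ν)

def a1 : ℝ := S.Bf * S.Im * S.If + S.Kf * S.Pm * S.Pf * (S.μ + S.ν)

def a0 : ℝ := S.Kf * S.Im * S.If

/-- The common denominator of `h₁₁` and `h₁₂`. -/
def den : ℝ[X] :=
  C S.a4 * X ^ 4 + C S.a3 * X ^ 3 + C S.a2 * X ^ 2 + C S.a1 * X + C S.a0

/-- The numerator of `h₁₁`. -/
def num11 : ℝ[X] :=
  C (S.Bf * S.M) * X ^ 4 + C (S.Bf * (S.B + S.Pm) + S.Kf * S.M) * X ^ 3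
    + C (S.Bf * S.Im + S.Kf * (S.B + S.Pm)) * X ^ 2 + C (S.Kf * S.Im) * X

/-- The numerator of `h₁₂`. -/
def num12 : ℝ[X] :=
  C (S.Bf * S.Pm * S.Pf) * X ^ 3 + C (S.Pm * S.Pf * (S.Kf + S.Bf * (S.μ + S.ν))) * X ^ 2
    + C (S.Bf * S.Im * S.If + S.Kf * S.Pm * S.Pf * (S.μ + S.ν)) * X + C (S.Kf * S.Im * S.If)

def h11 : RatFunc ℝ :=
  algebraMap ℝ[X] (RatFunc ℝ) S.num11 / algebraMap ℝ[X] (RatFunc ℝ) S.den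

def h12 : RatFunc ℝ :=
  algebraMap ℝ[X] (RatFunc ℝ) S.num12 / algebraMap ℝ[X] (RatFunc ℝ) S.den

/-- The contribution of the virtual coupler, a spring and a damper in parallel. -/
def h22 : RatFunc ℝ :=
  RatFunc.X / (RatFunc.C S.b22 * RatFunc.X + RatFunc.C S.k22)

/-- The hybrid matrix of SDEA under VSIC with the virtual coupler:
`(F_int, v_e) = H (-v_h, F_e)`. -/
def hybrid : Matrix (Fin 2) (Fin 2) (RatFunc ℝ) :=
  !![S.h11, S.h12; -1, S.h22]

/-- The upper bound on the squared stiffness `k₂₂²` of the virtual coupler. -/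
def stiffnessBound : ℝ :=
  4 * S.b22 * S.Im * (S.Im * S.Pf - S.B * S.If) * (S.Kf / (S.Im + S.α * S.Kf)) ^ 2

end SDEA

end

/-! With `Im = 0` common powers of `s` cancel and `H` becomes `[sN/P, 1 - sQ/P; -1, s/L]`, where
`P(0) = Kf Pm If`, `Q(0) = Kf α` and `L(0) = k22` are all positive. Near `s = 0` the coupling
departs from the lossless one, `[0, 1; -1, 0]`, at first order, whereas the diagonal entries are
reactive at that order and dissipate only at second order. The deficit therefore wins for slow
signals. On the imaginary axis the product of the real parts is `O(ω⁴)`, against `|h₁₂* + h₂₁|²/4 ~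
(ω Q(0) / (2 P(0)))²`. In time, a slow pulse makes the reactive energy an exact derivative
integrating to zero, and a negative multiple of `∫ (φ')²` remains. The third claim is immediate: the
bound has the factor `Im`. -/

open Filter Topology

/-! ### Constant-coefficient differential operators -/

/-- The space of smooth signals. -/
def smoothSignals : Submodule ℝ (ℝ → ℝ) where
  carrier := {u | ContDiff ℝ ∞ u}
  add_mem' {u v} (hu : ContDiff ℝ ∞ u) (hv : ContDiff ℝ ∞ v) := hu.add hv
  zero_mem' := (contDiff_const : ContDiff ℝ ∞ fun _ : ℝ => (0 : ℝ))
  smul_mem' c u (hu : ContDiff ℝ ∞ u) := hu.const_smul c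

/-- Differentiation, as an endomorphism of the space of smooth signals. -/
noncomputable def smoothDeriv : Module.End ℝ smoothSignals where
  toFun u := ⟨deriv u.1, (contDiff_infty_iff_deriv.1 u.2).2⟩
  map_add' u v := by
    ext t
    exact deriv_add ((contDiff_infty_iff_deriv.1 u.2).1 t) ((contDiff_infty_iff_deriv.1 v.2).1 t)
  map_smul' c u := by
    ext t
    exact deriv_const_mul c ((contDiff_infty_iff_deriv.1 u.2).1 t)

theorem smoothDeriv_pow_apply (n : ℕ) (u : smoothSignals) :
    ((smoothDeriv ^ n) u : ℝ → ℝ) = iteratedDeriv n u := by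
  induction n with
  | zero => simp
  | succ n ih =>
    rw [pow_succ', iteratedDeriv_succ, ← ih]
    rfl

/-- Makes `p ↦ p(d/dt)` an algebra homomorphism on smooth signals, so composition and subtraction
rules follow from `map_mul` and `map_sub`. -/
theorem diffOp_eq_aeval (p : ℝ[X]) (u : smoothSignals) :
    diffOp p u = (aeval smoothDeriv p u : smoothSignals).1 := by
  ext t
  rw [aeval_def, eval₂_eq_sum, diffOp, Polynomial.sum, Polynomial.sum, LinearMap.sum_apply,
    Submodule.coe_sum, Finset.sum_apply]
  refine Finset.sum_congr rfl fun i _ => ?_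
  rw [← smoothDeriv_pow_apply]
  simp

theorem contDiff_diffOp (p : ℝ[X]) {u : ℝ → ℝ} (hu : ContDiff ℝ ∞ u) :
    ContDiff ℝ ∞ (diffOp p u) := by
  have := (aeval smoothDeriv p (⟨u, hu⟩ : smoothSignals)).2
  rwa [← diffOp_eq_aeval] at this

theorem diffOp_mul (p q : ℝ[X]) {u : ℝ → ℝ} (hu : ContDiff ℝ ∞ u) :
    diffOp (p * q) u = diffOp p (diffOp q u) := by
  have h1 := diffOp_eq_aeval q ⟨u, hu⟩
  have h2 := diffOp_eq_aeval (p * q) ⟨u, hu⟩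
  have h3 := diffOp_eq_aeval p (aeval smoothDeriv q (⟨u, hu⟩ : smoothSignals))
  simp only at h1 h2
  rw [h1, h2, h3, map_mul]
  rfl

theorem diffOp_sub (p q : ℝ[X]) {u : ℝ → ℝ} (hu : ContDiff ℝ ∞ u) :
    diffOp (p - q) u = diffOp p u - diffOp q u := by
  have h1 := diffOp_eq_aeval q ⟨u, hu⟩
  have h2 := diffOp_eq_aeval p ⟨u, hu⟩
  have h3 := diffOp_eq_aeval (p - q) ⟨u, hu⟩
  simp only at h1 h2 h3
  rw [h1, h2, h3, map_sub]
  rfl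

theorem diffOp_neg (p : ℝ[X]) {u : ℝ → ℝ} (hu : ContDiff ℝ ∞ u) :
    diffOp (-p) u = -diffOp p u := by
  have h0 : diffOp 0 u = 0 := by
    ext t
    simp [diffOp]
  rw [← zero_sub, diffOp_sub 0 p hu, h0, zero_sub]

theorem diffOp_X (u : ℝ → ℝ) : diffOp X u = deriv u := by
  ext t
  rw [diffOp, sum_X_index (by simp), one_mul, iteratedDeriv_one]

theorem iteratedDeriv_eq_zero_of_rest {u : ℝ → ℝ} (hu : IsRestSignal u) (n : ℕ) :
    ∀ t ≤ 0, iteratedDeriv n u t = 0 := by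
  have hneg : ∀ t < 0, iteratedDeriv n u t = 0 := by
    intro t ht
    have : u =ᶠ[𝓝 t] fun _ => (0 : ℝ) :=
      (eventually_lt_nhds ht).mono fun x hx => hu.2 x hx.le
    rw [this.iteratedDeriv_eq]
    simp
  -- The signal is locally zero only at `t < 0`; continuity carries the conclusion to `t = 0`.
  have hc : Continuous (iteratedDeriv n u) := hu.1.continuous_iteratedDeriv n (by exact_mod_cast le_top)
  intro t ht
  have : t ∈ closure (Set.Iio (0 : ℝ)) := by
    rw [closure_Iio]
    exact ht
  exact (closure_minimal (fun x hx => hneg x hx) (isClosed_eq hc continuous_const)) this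

theorem IsRestSignal.diffOp (p : ℝ[X]) {u : ℝ → ℝ} (hu : IsRestSignal u) :
    IsRestSignal (diffOp p u) := by
  refine ⟨contDiff_diffOp p hu.1, fun t ht => ?_⟩
  rw [_root_.diffOp, Polynomial.sum]
  exact Finset.sum_eq_zero fun i _ => by rw [iteratedDeriv_eq_zero_of_rest hu i t ht, mul_zero]

theorem num_mul_eq_mul_denom {h : RatFunc ℝ} {n d : ℝ[X]} (hd : d ≠ 0)
    (hh : h = algebraMap ℝ[X] (RatFunc ℝ) n / algebraMap ℝ[X] (RatFunc ℝ) d) :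
    h.num * d = n * h.denom := by
  have h1 := RatFunc.num_div_denom h
  nth_rewrite 3 [hh] at h1
  rw [div_eq_div_iff (RatFunc.algebraMap_ne_zero h.denom_ne_zero)
    (RatFunc.algebraMap_ne_zero hd), ← map_mul, ← map_mul] at h1
  exact RatFunc.algebraMap_injective ℝ h1

/-- If `h = n / d`, not necessarily in lowest terms, then `n(d/dt) w` is the zero-state response
to `d(d/dt) w`. -/
theorem isResponse_diffOp {h : RatFunc ℝ} {n d : ℝ[X]} (hd : d ≠ 0)
    (hh : h = algebraMap ℝ[X] (RatFunc ℝ) n / algebraMap ℝ[X] (RatFunc ℝ) d)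
    {w : ℝ → ℝ} (hw : IsRestSignal w) : IsResponse h (diffOp d w) (diffOp n w) := by
  refine ⟨hw.diffOp n, ?_⟩
  rw [← diffOp_mul _ _ hw.1, ← diffOp_mul _ _ hw.1, num_mul_eq_mul_denom hd hh, mul_comm]

/-! ### Slow signals -/

/-- The operator `p(ε d/dt)` applied to a signal. -/
noncomputable def slowOp (p : ℝ[X]) (u : ℝ → ℝ) (ε t : ℝ) : ℝ :=
  p.sum fun i c => c * (ε ^ i * iteratedDeriv i u t)

theorem diffOp_comp_mul_left (p : ℝ[X]) {u : ℝ → ℝ} (hu : ContDiff ℝ ∞ u) (ε t : ℝ) :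
    diffOp p (fun t => u (ε * t)) t = slowOp p u ε (ε * t) := by
  rw [diffOp, slowOp, Polynomial.sum, Polynomial.sum]
  refine Finset.sum_congr rfl fun i _ => ?_
  have := congrFun (iteratedDeriv_comp_const_mul (n := i)
    (hu.of_le (by exact_mod_cast le_top)) ε) t
  rw [this]

theorem diffOp_X_mul_comp_mul_left (p : ℝ[X]) {u : ℝ → ℝ} (hu : ContDiff ℝ ∞ u) (ε t : ℝ) :
    diffOp (X * p) (fun t => u (ε * t)) t = ε * slowOp p (deriv u) ε (ε * t) := by
  have hu' := (contDiff_infty_iff_deriv.1 hu).2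
  have hw : ContDiff ℝ ∞ fun t => u (ε * t) := hu.comp (contDiff_const.mul contDiff_id)
  have hd : deriv (fun t => u (ε * t)) = fun t => ε * deriv u (ε * t) := by
    ext t
    rw [deriv_comp_mul_left, smul_eq_mul]
  rw [mul_comm, diffOp_mul _ _ hw, diffOp_X, hd, ← diffOp_comp_mul_left p hu', diffOp, diffOp,
    Polynomial.sum, Polynomial.sum, Finset.mul_sum]
  refine Finset.sum_congr rfl fun i _ => ?_
  rw [iteratedDeriv_const_mul_field]
  ring

/-- In the slow limit only the constant coefficient survives, since `0 ^ 0 = 1`. -/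
theorem slowOp_zero (p : ℝ[X]) (u : ℝ → ℝ) (t : ℝ) : slowOp p u 0 t = p.coeff 0 * u t := by
  rw [slowOp, Polynomial.sum_def, Finset.sum_eq_single 0]
  · simp
  · intro i _ hi
    simp [hi]
  · intro h
    simp [notMem_support_iff.1 h]

theorem continuous_slowOp (p : ℝ[X]) {u : ℝ → ℝ} (hu : ContDiff ℝ ∞ u) :
    Continuous fun x : ℝ × ℝ => slowOp p u x.1 x.2 := by
  simp only [slowOp, Polynomial.sum_def]
  refine continuous_finsetSum _ fun i _ => continuous_const.mul ((continuous_fst.pow i).mul ?_)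
  exact (hu.continuous_iteratedDeriv i (by exact_mod_cast le_top)).comp continuous_snd

/-- The vanishing of `φ` and `φ'` at both ends kills the reactive terms `φ'φ` and `φ''φ'`. -/
theorem exists_pulse : ∃ φ : ℝ → ℝ, IsRestSignal φ ∧ φ 1 = 0 ∧ deriv φ 1 = 0 ∧
    0 < ∫ t in (0 : ℝ)..1, deriv φ t ^ 2 := by
  set φ : ℝ → ℝ := fun x => expNegInvGlue x * expNegInvGlue (1 - x) with hφ
  have hs : ContDiff ℝ ∞ φ :=
    expNegInvGlue.contDiff.mul (expNegInvGlue.contDiff.comp (contDiff_const.sub contDiff_id))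
  have h0 : ∀ t ≤ 0, φ t = 0 := fun t ht => by simp [hφ, expNegInvGlue.zero_of_nonpos ht]
  have h1 : φ 1 = 0 := by simp [hφ, expNegInvGlue.zero_of_nonpos le_rfl]
  have hnn : ∀ t, 0 ≤ φ t := fun t => mul_nonneg (expNegInvGlue.nonneg _) (expNegInvGlue.nonneg _)
  have hd := contDiff_infty_iff_deriv.1 hs
  refine ⟨φ, ⟨hs, h0⟩, h1, ?_, ?_⟩
  · exact IsLocalMin.deriv_eq_zero (Eventually.of_forall fun x => by rw [h1]; exact hnn x)
  · refine intervalIntegral.integral_pos one_pos (hd.2.continuous.pow 2).continuousOn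
      (fun _ _ => sq_nonneg _) ?_
    obtain ⟨c, hc, hc'⟩ := exists_deriv_eq_slope φ (by norm_num : (0 : ℝ) < 1 / 2)
      hs.continuous.continuousOn hd.1.differentiableOn
    refine ⟨c, ⟨hc.1.le, by linarith [hc.2]⟩, ?_⟩
    have : 0 < φ (1 / 2) :=
      mul_pos (expNegInvGlue.pos_of_pos (by norm_num)) (expNegInvGlue.pos_of_pos (by norm_num))
    rw [hc', h0 0 le_rfl]
    positivity

theorem integral_mul_deriv_eq_zero {f : ℝ → ℝ} (hf : ContDiff ℝ ∞ f) (h0 : f 0 = 0)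
    (h1 : f 1 = 0) : ∫ t in (0 : ℝ)..1, deriv f t * f t = 0 := by
  have hd := contDiff_infty_iff_deriv.1 hf
  have h := intervalIntegral.integral_eq_sub_of_hasDerivAt (a := 0) (b := 1)
    (f := fun t => f t ^ 2 / 2) (f' := fun t => deriv f t * f t)
    (fun t _ => by
      refine (((hd.1 t).hasDerivAt.pow 2).div_const 2).congr_deriv ?_
      push_cast
      ring)
    ((hd.2.continuous.mul hf.continuous).intervalIntegrable _ _)
  rw [h, h0, h1, sub_self]

/-! ### Two-ports whose coupling differs from the ideal one to first order at low frequency -/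

/-- The two-port `[s N / P, 1 - s Q / P; -1, s / L]`. -/
noncomputable def lowFreqTwoPort (P N Q L : ℝ[X]) : Matrix (Fin 2) (Fin 2) (RatFunc ℝ) :=
  !![algebraMap ℝ[X] (RatFunc ℝ) (X * N) / algebraMap ℝ[X] (RatFunc ℝ) P,
    algebraMap ℝ[X] (RatFunc ℝ) (P - X * Q) / algebraMap ℝ[X] (RatFunc ℝ) P;
    -1, algebraMap ℝ[X] (RatFunc ℝ) X / algebraMap ℝ[X] (RatFunc ℝ) L]

theorem ne_zero_of_coeff_zero_pos {p : ℝ[X]} (hp : 0 < p.coeff 0) : p ≠ 0 := by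
  rintro rfl
  simp at hp

/-- Drive port 1 with `P w₁` and port 2 with `P L w₂`, where `w₁(t) = φ'(εt)` and `w₂(t) = φ(εt)`.
All responses are then explicit, with no differential equation to solve. -/
theorem not_twoPortPassive_lowFreqTwoPort {P N Q L : ℝ[X]} (hP : 0 < P.coeff 0)
    (hQ : 0 < Q.coeff 0) (hL : 0 < L.coeff 0) : ¬ TwoPortPassive (lowFreqTwoPort P N Q L) := by
  intro hpass
  obtain ⟨φ, hφ, hφ1, hφ1', hpos⟩ := exists_pulse
  set ψ := deriv φ with hψ
  have hψs : ContDiff ℝ ∞ ψ := (contDiff_infty_iff_deriv.1 hφ.1).2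
  have hψr : IsRestSignal ψ := by
    have := hφ.diffOp X
    rwa [diffOp_X] at this
  have hψ's : ContDiff ℝ ∞ (deriv ψ) := (contDiff_infty_iff_deriv.1 hψs).2
  have hP0 := ne_zero_of_coeff_zero_pos hP
  have hL0 := ne_zero_of_coeff_zero_pos hL
  -- The power at time `τ / ε` is `ε * G ε τ`: the terms `± (P w₁)(P L w₂)` cancel, and each
  -- remaining one has a factor `s`, hence `ε`. The energy up to time `1 / ε` is thus `∫ G ε` over
  -- `[0, 1]`, continuous in `ε` down to `0`.
  set G : ℝ → ℝ → ℝ := fun ε τ =>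
    slowOp N (deriv ψ) ε τ * slowOp P ψ ε τ - slowOp (Q * L) ψ ε τ * slowOp P ψ ε τ
      + slowOp P ψ ε τ * slowOp (P * L) φ ε τ with hG
  have hGc : Continuous (Function.uncurry G) :=
    (((continuous_slowOp N hψ's).mul (continuous_slowOp P hψs)).sub
      ((continuous_slowOp (Q * L) hψs).mul (continuous_slowOp P hψs))).add
      ((continuous_slowOp P hψs).mul (continuous_slowOp (P * L) hφ.1))
  have hEc : Continuous fun ε => ∫ τ in (0 : ℝ)..1, G ε τ :=
    intervalIntegral.continuous_parametric_intervalIntegral_of_continuous' hGc 0 1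
  have hE0 : ∫ τ in (0 : ℝ)..1, G 0 τ < 0 := by
    have hGe : ∀ τ, G 0 τ = N.coeff 0 * P.coeff 0 * (deriv ψ τ * ψ τ)
        - P.coeff 0 * Q.coeff 0 * L.coeff 0 * ψ τ ^ 2
        + P.coeff 0 ^ 2 * L.coeff 0 * (ψ τ * φ τ) := by
      intro τ
      simp only [hG, slowOp_zero, mul_coeff_zero]
      ring
    have i1 : IntervalIntegrable (fun τ => N.coeff 0 * P.coeff 0 * (deriv ψ τ * ψ τ))
        MeasureTheory.volume 0 1 :=
      (continuous_const.mul (hψ's.continuous.mul hψs.continuous)).intervalIntegrable _ _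
    have i2 : IntervalIntegrable (fun τ => P.coeff 0 * Q.coeff 0 * L.coeff 0 * ψ τ ^ 2)
        MeasureTheory.volume 0 1 :=
      (continuous_const.mul (hψs.continuous.pow 2)).intervalIntegrable _ _
    have i3 : IntervalIntegrable (fun τ => P.coeff 0 ^ 2 * L.coeff 0 * (ψ τ * φ τ))
        MeasureTheory.volume 0 1 :=
      (continuous_const.mul (hψs.continuous.mul hφ.1.continuous)).intervalIntegrable _ _
    simp only [hGe]
    rw [intervalIntegral.integral_add (i1.sub i2) i3, intervalIntegral.integral_sub i1 i2,
      intervalIntegral.integral_const_mul, intervalIntegral.integral_const_mul,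
      intervalIntegral.integral_const_mul,
      integral_mul_deriv_eq_zero hψs (hψr.2 0 le_rfl) hφ1',
      integral_mul_deriv_eq_zero hφ.1 (hφ.2 0 le_rfl) hφ1]
    have : 0 < P.coeff 0 * Q.coeff 0 * L.coeff 0 * ∫ t in (0 : ℝ)..1, ψ t ^ 2 :=
      mul_pos (by positivity) hpos
    linarith
  obtain ⟨ε, hεneg, hε⟩ : ∃ ε, (∫ τ in (0 : ℝ)..1, G ε τ) < 0 ∧ 0 < ε :=
    (((hEc.tendsto 0).eventually_lt_const hE0).filter_mono nhdsWithin_le_nhds |>.and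
      (self_mem_nhdsWithin : Set.Ioi (0 : ℝ) ∈ 𝓝[>] 0)).exists
  have hslow : ∀ {u : ℝ → ℝ}, IsRestSignal u → IsRestSignal fun t => u (ε * t) := fun hu =>
    ⟨hu.1.comp (contDiff_const.mul contDiff_id),
      fun t ht => hu.2 _ (mul_nonpos_of_nonneg_of_nonpos hε.le ht)⟩
  set w₁ : ℝ → ℝ := fun t => ψ (ε * t) with hw₁
  set w₂ : ℝ → ℝ := fun t => φ (ε * t) with hw₂
  have h₁ : IsRestSignal w₁ := hslow hψr
  have h₂ : IsRestSignal w₂ := hslow hφ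
  have key := hpass ![diffOp P w₁, diffOp (P * L) w₂]
    ![![diffOp (X * N) w₁, diffOp ((P - X * Q) * L) w₂],
      ![diffOp (-P) w₁, diffOp (X * P) w₂]]
    (by
      intro j
      fin_cases j
      · exact h₁.diffOp P
      · exact h₂.diffOp (P * L))
    (by
      have hPL : P * L ≠ 0 := mul_ne_zero hP0 hL0
      have hP' := RatFunc.algebraMap_ne_zero (K := ℝ) hP0
      have hL' := RatFunc.algebraMap_ne_zero (K := ℝ) hL0
      intro i j
      fin_cases i <;> fin_cases j
      · exact isResponse_diffOp hP0 rfl h₁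
      · refine isResponse_diffOp hPL ?_ h₂
        rw [map_mul, map_mul, mul_div_mul_right _ _ hL']
        rfl
      · refine isResponse_diffOp hP0 ?_ h₁
        rw [map_neg, neg_div, div_self hP']
        rfl
      · refine isResponse_diffOp hPL ?_ h₂
        rw [map_mul, map_mul, mul_comm, mul_div_mul_left _ _ hP']
        rfl)
    ε⁻¹ (inv_nonneg.2 hε.le)
  have hpower : ∀ t, (∑ i, (∑ j, (![![diffOp (X * N) w₁, diffOp ((P - X * Q) * L) w₂],
      ![diffOp (-P) w₁, diffOp (X * P) w₂]] : Fin 2 → Fin 2 → ℝ → ℝ) i j t) *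
        (![diffOp P w₁, diffOp (P * L) w₂] : Fin 2 → ℝ → ℝ) i t) = ε * G ε (ε * t) := by
    intro t
    have e : (P - X * Q) * L = P * L - X * (Q * L) := by ring
    simp only [Fin.sum_univ_two, Matrix.cons_val_zero, Matrix.cons_val_one]
    rw [e, diffOp_sub _ _ h₂.1, diffOp_neg _ h₁.1, Pi.sub_apply, Pi.neg_apply,
      diffOp_X_mul_comp_mul_left _ hψs, diffOp_X_mul_comp_mul_left _ hφ.1,
      diffOp_X_mul_comp_mul_left _ hφ.1, diffOp_comp_mul_left _ hψs,
      diffOp_comp_mul_left _ hφ.1, hG, ← hψ]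
    ring
  simp only [hpower] at key
  rw [intervalIntegral.integral_comp_mul_left (fun x => ε * G ε x) hε.ne', mul_zero,
    mul_inv_cancel₀ hε.ne', intervalIntegral.integral_const_mul, smul_eq_mul,
    inv_mul_cancel_left₀ hε.ne'] at key
  exact absurd key (not_le.2 hεneg)

/-! ### The frequency-domain criterion at low frequency -/

theorem not_isPole_of_eq_div {h : RatFunc ℝ} {n d : ℝ[X]}
    (hh : h = algebraMap ℝ[X] (RatFunc ℝ) n / algebraMap ℝ[X] (RatFunc ℝ) d) {s : ℂ}
    (hs : aeval s d ≠ 0) : ¬ IsPole h s := by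
  intro hp
  obtain ⟨r, hr⟩ := RatFunc.denom_div_dvd n d
  rw [← hh] at hr
  exact hs (by rw [hr, map_mul, hp, zero_mul])

theorem freqResponse_of_eq_div {h : RatFunc ℝ} {n d : ℝ[X]}
    (hh : h = algebraMap ℝ[X] (RatFunc ℝ) n / algebraMap ℝ[X] (RatFunc ℝ) d) {s : ℂ}
    (hs : aeval s d ≠ 0) : freqResponse h s = aeval s n / aeval s d := by
  have hd : d ≠ 0 := by
    rintro rfl
    simp at hs
  have := congrArg (aeval s) (num_mul_eq_mul_denom hd hh)
  rw [map_mul, map_mul] at this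
  change aeval s h.num / aeval s h.denom = _
  rwa [div_eq_div_iff (not_isPole_of_eq_div hh hs) hs]

theorem not_twoPortPassiveFreq_lowFreqTwoPort {P N Q L : ℝ[X]} (hP : 0 < P.coeff 0)
    (hQ : 0 < Q.coeff 0) (hL : 0 < L.coeff 0) :
    ¬ TwoPortPassiveFreq (lowFreqTwoPort P N Q L) := by
  intro hpass
  have hc : ∀ p : ℝ[X], Continuous fun w : ℝ => aeval ((w : ℂ) * Complex.I) p := fun p =>
    p.continuous_aeval.comp (Complex.continuous_ofReal.mul continuous_const)
  have h0 : ∀ p : ℝ[X], aeval (((0 : ℝ) : ℂ) * Complex.I) p = (p.coeff 0 : ℂ) := by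
    intro p
    rw [Complex.ofReal_zero, zero_mul, ← coeff_zero_eq_aeval_zero']
    rfl
  have hne : ∀ p : ℝ[X], 0 < p.coeff 0 → aeval (((0 : ℝ) : ℂ) * Complex.I) p ≠ 0 := by
    intro p hp
    rw [h0]
    exact_mod_cast hp.ne'
  -- The determinant expression of `real_part` divided by `w ^ 2`, which extends continuously to `w
  -- = 0`. There the first term vanishes, as `I` times a real number has no real part.
  set F : ℝ → ℝ := fun w =>
    (Complex.I * (aeval ((w : ℂ) * Complex.I) N / aeval ((w : ℂ) * Complex.I) P)).re *
      (Complex.I * (1 / aeval ((w : ℂ) * Complex.I) L)).re -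
    (‖aeval ((w : ℂ) * Complex.I) Q / aeval ((w : ℂ) * Complex.I) P‖ / 2) ^ 2 with hF
  have hFc : ContinuousAt F 0 := by
    have cN := (hc N).continuousAt.div (hc P).continuousAt (hne P hP)
    have cL := (continuousAt_const (y := (1 : ℂ))).div (hc L).continuousAt (hne L hL)
    have cQ := (hc Q).continuousAt.div (hc P).continuousAt (hne P hP)
    exact ((Complex.continuous_re.continuousAt.comp (continuousAt_const.mul cN)).mul
      (Complex.continuous_re.continuousAt.comp (continuousAt_const.mul cL))).sub
      ((cQ.norm.div_const 2).pow 2)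
  have hF0 : F 0 < 0 := by
    have : 0 < ‖(Q.coeff 0 : ℂ) / (P.coeff 0 : ℂ)‖ := by
      rw [norm_pos_iff]
      exact div_ne_zero (by exact_mod_cast hQ.ne') (by exact_mod_cast hP.ne')
    simp only [hF, h0]
    rw [← Complex.ofReal_div (N.coeff 0), Complex.I_mul_re, Complex.ofReal_im, neg_zero, zero_mul,
      zero_sub, neg_lt_zero]
    positivity
  obtain ⟨w, ⟨⟨hFw, hPw⟩, hLw⟩, hw⟩ : ∃ w : ℝ, ((F w < 0 ∧
      aeval ((w : ℂ) * Complex.I) P ≠ 0) ∧ aeval ((w : ℂ) * Complex.I) L ≠ 0) ∧ 0 < w :=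
    ((((hFc.eventually_lt_const hF0).and ((hc P).continuousAt.eventually_ne (hne P hP))).and
      ((hc L).continuousAt.eventually_ne (hne L hL))).filter_mono nhdsWithin_le_nhds |>.and
      (self_mem_nhdsWithin : Set.Ioi (0 : ℝ) ∈ 𝓝[>] 0)).exists
  set s : ℂ := (w : ℂ) * Complex.I with hs
  have e00 : lowFreqTwoPort P N Q L 0 0 = algebraMap ℝ[X] (RatFunc ℝ) (X * N) /
    algebraMap ℝ[X] (RatFunc ℝ) P := rfl
  have e01 : lowFreqTwoPort P N Q L 0 1 = algebraMap ℝ[X] (RatFunc ℝ) (P - X * Q) /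
    algebraMap ℝ[X] (RatFunc ℝ) P := rfl
  have e10 : lowFreqTwoPort P N Q L 1 0 = algebraMap ℝ[X] (RatFunc ℝ) (-1) /
    algebraMap ℝ[X] (RatFunc ℝ) 1 := by
    rw [map_neg, map_one, div_one]
    rfl
  have e11 : lowFreqTwoPort P N Q L 1 1 = algebraMap ℝ[X] (RatFunc ℝ) X /
    algebraMap ℝ[X] (RatFunc ℝ) L := rfl
  have h1 : aeval s (1 : ℝ[X]) ≠ 0 := by simp
  have key := (hpass.real_part w (by
    intro i j
    fin_cases i <;> fin_cases j
    · exact not_isPole_of_eq_div e00 hPw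
    · exact not_isPole_of_eq_div e01 hPw
    · exact not_isPole_of_eq_div e10 h1
    · exact not_isPole_of_eq_div e11 hLw)).2.2
  rw [freqResponse_of_eq_div e00 hPw, freqResponse_of_eq_div e01 hPw,
    freqResponse_of_eq_div e10 h1, freqResponse_of_eq_div e11 hLw] at key
  simp only [map_mul, map_sub, map_neg, map_one, aeval_X] at key
  have r00 : (s * aeval s N / aeval s P).re =
      w * (Complex.I * (aeval s N / aeval s P)).re := by
    rw [← Complex.re_ofReal_mul, hs]
    congr 1
    ring
  have r11 : (s / aeval s L).re = w * (Complex.I * (1 / aeval s L)).re := by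
    rw [← Complex.re_ofReal_mul, hs]
    congr 1
    ring
  have r01 : ‖((starRingEnd ℂ) ((aeval s P - s * aeval s Q) / aeval s P) + -1 / 1) / 2‖ =
      w * (‖aeval s Q / aeval s P‖ / 2) := by
    -- The ideal coupling `1` cancels against `h₂₁ = -1`, leaving only the defect.
    have : (starRingEnd ℂ) ((aeval s P - s * aeval s Q) / aeval s P) + -1 / 1 =
        (starRingEnd ℂ) (-(s * (aeval s Q / aeval s P))) := by
      rw [sub_div, div_self hPw, map_sub, map_one, map_neg, mul_div_assoc]
      ring
    rw [this, norm_div, RCLike.norm_conj, norm_neg, norm_mul, hs, norm_mul, Complex.norm_I,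
      Complex.norm_real, Real.norm_of_nonneg hw.le, ← hs, RCLike.norm_ofNat]
    ring
  have : 0 ≤ w ^ 2 * F w := by
    rw [r00, r11, r01] at key
    simp only [hF, ← hs]
    linarith
  nlinarith [mul_pos (pow_pos hw 2) (neg_pos.2 hFw)]

/-! ### The actuator without integral motion control -/

namespace SDEA

variable (S : SDEA)

/-- Without integral motion control, `S.den = X * S.den₀`. -/
noncomputable def den₀ : ℝ[X] :=
  C S.a4 * X ^ 3 + C S.a3 * X ^ 2 + C S.a2 * X + C S.a1

/-- Without integral motion control, `S.num11 = X ^ 2 * S.num11₀`. -/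
noncomputable def num11₀ : ℝ[X] :=
  C (S.Bf * S.M) * X ^ 2 + C (S.Bf * (S.B + S.Pm) + S.Kf * S.M) * X + C (S.Kf * (S.B + S.Pm))

/-- Without integral motion control, `S.den - S.num12 = X ^ 2 * S.defect`. -/
noncomputable def defect : ℝ[X] :=
  C S.M * X ^ 2 + C (S.B + S.Pm + S.Bf * S.α) * X + C (S.Kf * S.α)

/-- The denominator of `S.h22`. -/
noncomputable def coupler : ℝ[X] :=
  C S.b22 * X + C S.k22

theorem hybrid_eq_lowFreqTwoPort (hIm : S.Im = 0) :
    S.hybrid = lowFreqTwoPort S.den₀ S.num11₀ S.defect S.coupler := by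
  have hX : algebraMap ℝ[X] (RatFunc ℝ) X ≠ 0 := RatFunc.algebraMap_ne_zero X_ne_zero
  have hden : S.den = X * S.den₀ := by
    simp only [den, den₀, a0, hIm, mul_zero, zero_mul, C_0]
    ring
  have h11 : S.num11 = X * (X * S.num11₀) := by
    simp only [num11, num11₀, hIm, mul_zero, C_0, zero_add]
    ring
  have h12 : S.num12 = X * (S.den₀ - X * S.defect) := by
    simp only [num12, den₀, defect, a1, a2, a3, a4, μ, hIm, mul_zero, zero_mul, zero_div, C_0,
      zero_add, C_add, C_mul]
    ring
  rw [hybrid, lowFreqTwoPort, SDEA.h11, SDEA.h12, SDEA.h22, hden, h11, h12, map_mul,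
    map_mul _ X S.den₀, map_mul _ X (S.den₀ - _), mul_div_mul_left _ _ hX,
    mul_div_mul_left _ _ hX, coupler, map_add, map_mul _ (C S.b22), RatFunc.algebraMap_X,
    RatFunc.algebraMap_C, RatFunc.algebraMap_C]

theorem coeff_zero_den₀_pos (hKf : 0 < S.Kf) (hPm : 0 < S.Pm) (hPf : 0 < S.Pf)
    (hIf : 0 < S.If) (hIm : S.Im = 0) : 0 < S.den₀.coeff 0 := by
  have : S.den₀.coeff 0 = S.Kf * S.Pm * S.Pf * (S.If / S.Pf) := by
    simp [den₀, a1, μ, ν, hIm]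
  rw [this]
  positivity

theorem coeff_zero_defect : S.defect.coeff 0 = S.Kf * S.α := by
  simp [defect]

theorem coeff_zero_coupler : S.coupler.coeff 0 = S.k22 := by
  simp [coupler]

end SDEA

theorem mainTheorem8 (S : SDEA)
    (hM : 0 < S.M) (hB : 0 < S.B) (hKf : 0 < S.Kf) (hPm : 0 < S.Pm) (hPf : 0 < S.Pf)
    (hBf : 0 ≤ S.Bf) (hIm : 0 ≤ S.Im) (hIf : 0 ≤ S.If) (hb22 : 0 ≤ S.b22) (hk22 : 0 ≤ S.k22)
    (hα0 : 0 ≤ S.α) (hα1 : S.α ≤ 1) (hbound : S.Im + S.α * S.Kf ≠ 0) :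
    (S.If ≠ 0 → TwoPortPassive S.hybrid → S.k22 ≠ 0 → S.Im ≠ 0) ∧
    (S.If ≠ 0 → TwoPortPassiveFreq S.hybrid → S.k22 ≠ 0 → S.Im ≠ 0) ∧
    (S.Im = 0 → S.k22 ^ 2 ≤ S.stiffnessBound → S.k22 = 0) := by
  have hQ : S.Im = 0 → 0 < S.defect.coeff 0 := by
    intro h0
    rw [S.coeff_zero_defect]
    -- With `Im = 0`, definedness of the bound says precisely that `α * Kf ≠ 0`, so `α > 0`.
    refine mul_pos hKf (lt_of_le_of_ne hα0 fun h => hbound ?_)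
    rw [h0, ← h, zero_mul, zero_add]
  have hP : S.If ≠ 0 → S.Im = 0 → 0 < S.den₀.coeff 0 := fun h =>
    S.coeff_zero_den₀_pos hKf hPm hPf (lt_of_le_of_ne hIf h.symm)
  have hL : S.k22 ≠ 0 → 0 < S.coupler.coeff 0 := fun h => by
    rw [S.coeff_zero_coupler]
    exact lt_of_le_of_ne hk22 h.symm
  refine ⟨fun hf hpass hk h0 => ?_, fun hf hpass hk h0 => ?_, fun h0 hle => ?_⟩
  · rw [S.hybrid_eq_lowFreqTwoPort h0] at hpass
    exact not_twoPortPassive_lowFreqTwoPort (hP hf h0) (hQ h0) (hL hk) hpass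
  · rw [S.hybrid_eq_lowFreqTwoPort h0] at hpass
    exact not_twoPortPassiveFreq_lowFreqTwoPort (hP hf h0) (hQ h0) (hL hk) hpass
  · rw [SDEA.stiffnessBound, h0, mul_zero, zero_mul, zero_mul] at hle
    exact pow_eq_zero_iff two_ne_zero |>.1 (le_antisymm hle (sq_nonneg _))
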